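/- Let $K\ge 1$ and consider a memoryless, time-invariant 1-to-$K$ broadcast packet erasure channel: in each use the source sends a symbol $Y\in\mathrm{GF}(q)$, and each receiver $k\in[K]=\{1,\dots,K\}$ observes either $Z_k=Y$ or an erasure $Z_k=*$. For $S\subseteq[K]$, let $p_{S\overline{[K]\setminus S}}\ge 0$ be the probability that exactly the receivers in $S$ receive $Y$, where $\sum_{S\subseteq[K]} p_{S\overline{[K]\setminus S}}=1$; this probability does not depend on the value of $Y$, and arbitrary dependence between the receivers is allowed. Let $p_{\cup S}=\sum_{S'\subseteq[K]:\,S'\cap S\ne\emptyset}p_{S'\overline{[K]\setminus S'}}$ be the probability that at least one receiver in $S$ receives $Y$. A code of length $n$ with channel output feedback for a rate vector $(R_1,\dots,R_K)\in[0,\infty)^K$ has, for each $k\in[K]$, a message $\mathbf X_k$ of $\lfloor nR_k\rfloor$ symbols, all symbols of all messages being independent and uniform on $\mathrm{GF}(q)$. The symbol sent in slot $t\in[n]$ is a function $Y(t)=f_t\big(\mathbf X_1,\dots,\mathbf X_K,\mathbf Z(1),\dots,\mathbf Z(t-1)\big)$ of the messages and of the previous output vectors $\mathbf Z(\tau)=(Z_1(\tau),\dots,Z_K(\tau))$,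 and receiver $k$ outputs $\hat{\mathbf X}_k=g_k\big(Z_k(1),\dots,Z_k(n)\big)$. The rate vector is achievable if for every $\epsilon>0$ there are arbitrarily large $n$ for which there exist a finite field $\mathrm{GF}(q)$ and such a code with $\mathrm{Prob}(\hat{\mathbf X}_k\ne\mathbf X_k)<\epsilon$ for all $k\in[K]$. Then every achievable rate vector satisfies the $K!$ inequalities $$\sum_{j=1}^{K}\frac{R_{\pi(j)}}{p_{\cup S^\pi_j}}\le 1\qquad\text{for every permutation }\pi\text{ of }[K],$$ where $S^\pi_j=\{\pi(1),\dots,\pi(j)\}$. If $p_{\cup S^\pi_j}=0$, the $j$-th term is read as $0$ when $R_{\pi(j)}=0$ and as $+\infty$ otherwise; in particular the inequality then forces $R_{\pi(j)}=0$. -/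

import Mathlib

open scoped BigOperators

namespace BroadcastErasure

/-- A memoryless, time-invariant 1-to-`K` broadcast packet erasure channel, given by its success
probabilities: `p S` is the probability that the transmitted symbol is received by, and only by,
the receivers in `S`. Arbitrary dependence between the receivers is allowed. -/
structure PEC (K : ℕ) where
  p : Finset (Fin K) → ℝ
  p_nonneg : ∀ S, 0 ≤ p S
  p_sum : ∑ S, p S = 1

/-- `p_{∪S}`: the probability that at least one receiver in `S` receives the symbol. -/
def PEC.pUnion {K : ℕ} (W : PEC K) (S : Finset (Fin K)) : ℝ :=
  ∑ S' : Finset (Fin K) with (S' ∩ S).Nonempty, W.p S'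

/-- The output vector of one channel use; `none` is the erasure symbol. -/
abbrev Output (K : ℕ) (F : Type) : Type := Fin K → Option F

open Classical in
/-- The transition probability `Prob (Z = z | Y = y)` of one channel use: each coordinate of the
output is an erasure or the input `y`, and the set of receivers that obtain `y` has law `p`. -/
noncomputable def PEC.transition {K : ℕ} (W : PEC K) {F : Type} (y : F) (z : Output K F) : ℝ :=
  if ∀ k, z k = none ∨ z k = some y then W.p {k | z k = some y} else 0

/-- The messages of the `K` sessions; session `k` consists of `m k` symbols of `F`. -/
abbrev Messages {K : ℕ} (m : Fin K → ℕ) (F : Type) : Type := (k : Fin K) → Fin (m k) → F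

/-- A code of length `n` with channel output feedback. The symbol sent in slot `t` is a function
of all messages and of the complete channel outputs (of all receivers) in the earlier slots;
receiver `k` decodes its own message from its own `n` observations. -/
structure FeedbackCode {K : ℕ} (n : ℕ) (m : Fin K → ℕ) (F : Type) where
  enc : (t : Fin n) → Messages m F → (Fin t → Output K F) → F
  dec : (k : Fin K) → (Fin n → Option F) → (Fin (m k) → F)

/-- The joint probability that the messages are `x` and the channel outputs in slots
`0, …, n - 1` are `z`: the message symbols are independent and uniform on `F`, and given the
messages and the past outputs, the output in slot `t` is produced by a fresh use of the channel
on the symbol chosen by the encoder. -/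
noncomputable def FeedbackCode.jointProb {K n : ℕ} {m : Fin K → ℕ} {F : Type} [Fintype F]
    (C : FeedbackCode n m F) (W : PEC K) (x : Messages m F) (z : Fin n → Output K F) : ℝ :=
  (Fintype.card (Messages m F) : ℝ)⁻¹ *
    ∏ t : Fin n, W.transition (C.enc t x fun τ => z ⟨τ, τ.isLt.trans t.isLt⟩) (z t)

open Classical in
/-- The probability that receiver `k` decodes its message incorrectly. -/
noncomputable def FeedbackCode.errorProb {K n : ℕ} {m : Fin K → ℕ} {F : Type} [Fintype F]
    (C : FeedbackCode n m F) (W : PEC K) (k : Fin K) : ℝ :=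
  ∑ x : Messages m F, ∑ z : Fin n → Output K F,
    if C.dec k (fun t => z t k) ≠ x k then C.jointProb W x z else 0

/-- The nonnegative rate vector `R` is achievable over `W` with channel output feedback: for every
`ε > 0` there are arbitrarily large block lengths `n`, a finite field `F` and a code of length `n`
carrying `⌊n R k⌋` symbols of `F` for each receiver `k`, all of whose error probabilities are
below `ε`. The field may be taken as large as one likes, but no minimal size is demanded; this
can only make more rate vectors achievable. -/
def Achievable {K : ℕ} (W : PEC K) (R : Fin K → ℝ) : Prop :=
  (∀ k, 0 ≤ R k) ∧
    ∀ ε : ℝ, 0 < ε → ∀ n₀ : ℕ, ∃ n : ℕ, n₀ ≤ n ∧ ∃ (F : Type) (_ : Field F) (_ : Fintype F)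
      (C : FeedbackCode n (fun k => ⌊(n : ℝ) * R k⌋₊) F), ∀ k, C.errorProb W k < ε

/-- The set `S^π_j` of the first receivers, up to and including the `j`-th one, in the
order `π`. -/
def firstReceivers {K : ℕ} (π : Equiv.Perm (Fin K)) (j : Fin K) : Finset (Fin K) :=
  (Finset.Iic j).image π

end BroadcastErasure

/-!
The bound is an entropy argument that lets the receivers cooperate along the order `π`. Let `T_j`
be the first `j` receivers, let `U_j^t` be what they have jointly observed before slot `t`, `W_j`
the `j`-th message in this order, and `Y_t` the symbol sent in slot `t`.

The reception set of slot `t` is independent of `Y_t` and of everything before, so the joint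
observation of `T_j` in slot `t` behaves like an erased copy of `Y_t`, and it conveys
`p_{∪T_j}` times the information about `W_j` that `Y_t` itself would convey
(`FiniteEntropy.entropy_erased`, `FeedbackCode.entropy_history_succ`). The contribution of the
reception set itself does not depend on the conditioning and cancels. Together with Fano's inequality
for the `j`-th receiver, which belongs to `T_j`, this gives (`FeedbackCode.message_le`)
`H(W_j) - (Fano term) ≤ p_{∪T_j} * ∑ t, (H(Y_t | U_j^t, W_{<j}) - H(Y_t | U_j^t, W_{≤j}))`.
Feedback is harmless because `Y_t` may be any function of the messages and the earlier reception
sets.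

After division by `p_{∪T_j}`, the sum over `j` is bounded by a telescoping one: conditioning on
less gives `H(Y_t | U_j^t, W_{<j}) ≤ H(Y_t | U_{j-1}^t, W_{<j})`, so at most `H(Y_t) ≤ log |F|`
remains per slot (`FeedbackCode.sum_information_le`). Measured in units of `log |F|`, the Fano
term is bounded by a constant plus a small multiple of the message length, whatever the field is,
and disappears in the limit of long codes.

The sample space consists of the messages and the reception sets, so that independence of the
channel uses is a product structure; `FeedbackCode.sum_jointProb` identifies its image with the
joint law of messages and outputs.
-/

/-! ### Entropy on a finite probability space -/

namespace FiniteEntropy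

open scoped Classical in
/-- The probability `P (f = f ω)` that the random variable `f` takes the value it has at `ω`. -/
noncomputable def fiberProb {Ω α : Type*} [Fintype Ω] (P : Ω → ℝ) (f : Ω → α) (ω : Ω) : ℝ :=
  ∑ ω', if f ω' = f ω then P ω' else 0

/-- The Shannon entropy, in nats, of the random variable `f` under the weights `P`, written as the
expectation of `-log P (f = f ω)`. It depends on `f` only through the partition of `Ω` into the
fibres of `f`, and makes sense for any codomain. -/
noncomputable def entropy {Ω α : Type*} [Fintype Ω] (P : Ω → ℝ) (f : Ω → α) : ℝ :=
  -∑ ω, P ω * Real.log (fiberProb P f ω)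

/-- The conditional entropy of `f` given `g`, defined through the chain rule. -/
noncomputable def condEntropy {Ω α β : Type*} [Fintype Ω] (P : Ω → ℝ) (f : Ω → α) (g : Ω → β) : ℝ :=
  entropy P (fun ω => (f ω, g ω)) - entropy P g

section

variable {Ω : Type*} [Fintype Ω] {P : Ω → ℝ} {α β γ : Type*}

lemma entropy_congr {f : Ω → α} {g : Ω → β} (h : ∀ ω ω', f ω' = f ω ↔ g ω' = g ω) :
    entropy P f = entropy P g := by
  unfold entropy fiberProb
  congr! 8
  exact h _ _

lemma fiberProb_pos (hP : P ∈ stdSimplex ℝ Ω) (f : Ω → α) {ω : Ω} (h : 0 < P ω) :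
    0 < fiberProb P f ω := by
  classical
  refine h.trans_le ?_
  have := Finset.single_le_sum (f := fun ω' => if f ω' = f ω then P ω' else 0)
    (fun ω' _ => by split_ifs; exacts [hP.1 ω', le_rfl]) (Finset.mem_univ ω)
  simpa [fiberProb] using this

lemma fiberProb_mono (hP : P ∈ stdSimplex ℝ Ω) {f : Ω → α} {g : Ω → β} {ω : Ω}
    (h : ∀ ω', f ω' = f ω → g ω' = g ω) : fiberProb P f ω ≤ fiberProb P g ω := by
  classical
  refine Finset.sum_le_sum fun ω' _ => ?_
  by_cases h1 : f ω' = f ω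
  · simp [h1, h ω' h1]
  · rw [if_neg h1]; split_ifs; exacts [hP.1 ω', le_rfl]

lemma fiberProb_congr {f : Ω → α} {ω ω' : Ω} (h : f ω = f ω') :
    fiberProb P f ω = fiberProb P f ω' := by
  unfold fiberProb
  rw [h]

lemma condEntropy_eq_sum (f : Ω → α) (g : Ω → β) :
    condEntropy P f g = ∑ ω, P ω * (Real.log (fiberProb P g ω) -
      Real.log (fiberProb P (fun ω => (f ω, g ω)) ω)) := by
  simp only [condEntropy, entropy, mul_sub, Finset.sum_sub_distrib]
  ring

lemma condEntropy_nonneg (hP : P ∈ stdSimplex ℝ Ω) (f : Ω → α) (g : Ω → β) :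
    0 ≤ condEntropy P f g := by
  rw [condEntropy_eq_sum]
  refine Finset.sum_nonneg fun ω _ => ?_
  rcases (hP.1 ω).eq_or_lt with h | h
  · simp [← h]
  · refine mul_nonneg h.le (sub_nonneg.2 (Real.log_le_log (fiberProb_pos hP _ h) ?_))
    exact fiberProb_mono hP fun ω' h => congrArg Prod.snd h

/-- The normalisation behind `condEntropy_le_of_kernel`: weighting by the likelihood ratio of a
subprobability kernel `q` against the conditional law of `f` given `g` gives total mass at most
one. -/
lemma sum_likelihood_ratio_le_one [Fintype α] (hP : P ∈ stdSimplex ℝ Ω) (f : Ω → α) (g : Ω → β)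
    (q : α → Ω → ℝ) (hq : ∀ a ω, 0 ≤ q a ω) (hsum : ∀ ω, ∑ a, q a ω ≤ 1)
    (hconst : ∀ a ω ω', g ω = g ω' → q a ω = q a ω') :
    ∑ ω, P ω * (fiberProb P g ω * q (f ω) ω / fiberProb P (fun ω => (f ω, g ω)) ω) ≤ 1 := by
  classical
  set r := fiberProb P (fun ω => (f ω, g ω)) with hr
  have hinner : ∀ (a : α) (ω' : Ω),
      ∑ ω, (if g ω' = g ω ∧ f ω = a then P ω / r ω else 0) ≤ 1 := by
    intro a ω'
    by_cases hex : ∃ ω₀, g ω' = g ω₀ ∧ f ω₀ = a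
    · obtain ⟨ω₀, hg, hf⟩ := hex
      have : ∑ ω, (if g ω' = g ω ∧ f ω = a then P ω / r ω else 0) = r ω₀ / r ω₀ := by
        conv_rhs => arg 1; rw [hr, fiberProb]
        rw [Finset.sum_div]
        refine Finset.sum_congr rfl fun ω _ => ?_
        by_cases h : g ω' = g ω ∧ f ω = a
        · have h' : (f ω, g ω) = (f ω₀, g ω₀) := by rw [h.2, hf, ← h.1, hg]
          rw [if_pos h, if_pos h']
          congr 1
          exact fiberProb_congr (f := fun ω => (f ω, g ω)) h'
        · rw [if_neg h, if_neg, zero_div]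
          intro h'
          simp only [Prod.mk.injEq] at h'
          exact h ⟨hg.trans h'.2.symm, h'.1.trans hf⟩
      rw [this]
      exact div_self_le_one _
    · push Not at hex
      rw [Finset.sum_eq_zero]
      · exact zero_le_one
      · intro ω _
        rw [if_neg]
        exact fun h => hex ω h.1 h.2
  calc ∑ ω, P ω * (fiberProb P g ω * q (f ω) ω / r ω)
      = ∑ ω, ∑ ω', P ω' * ∑ a, q a ω' * (if g ω' = g ω ∧ f ω = a then P ω / r ω else 0) := by
        refine Finset.sum_congr rfl fun ω _ => ?_
        rw [fiberProb, Finset.sum_mul, Finset.sum_div, Finset.mul_sum]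
        refine Finset.sum_congr rfl fun ω' _ => ?_
        by_cases h : g ω' = g ω
        · rw [if_pos h, Finset.sum_eq_single (f ω)]
          · rw [if_pos ⟨h, rfl⟩, hconst _ _ _ h]
            ring
          · intro a _ ha
            rw [if_neg (fun h' => ha h'.2.symm), mul_zero]
          · simp
        · simp [h]
    _ = ∑ ω', P ω' * ∑ a, q a ω' * ∑ ω, (if g ω' = g ω ∧ f ω = a then P ω / r ω else 0) := by
        rw [Finset.sum_comm]
        refine Finset.sum_congr rfl fun ω' _ => ?_
        rw [← Finset.mul_sum, Finset.sum_comm]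
        simp only [Finset.mul_sum]
    _ ≤ ∑ ω', P ω' * 1 := by
        refine Finset.sum_le_sum fun ω' _ => mul_le_mul_of_nonneg_left ?_ (hP.1 ω')
        refine le_trans (Finset.sum_le_sum fun a _ => ?_) (hsum ω')
        exact mul_le_of_le_one_right (hq a ω') (hinner a ω')
    _ = 1 := by simpa using hP.2

/-- Gibbs' inequality: the conditional entropy of `f` given `g` is at most the expected code length
`-log q` of any subprobability kernel `q` that depends on `ω` only through `g ω`. All the entropy
bounds below are instances of this one. -/
lemma condEntropy_le_of_kernel [Fintype α] (hP : P ∈ stdSimplex ℝ Ω) (f : Ω → α) (g : Ω → β)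
    (q : α → Ω → ℝ) (hq : ∀ a ω, 0 ≤ q a ω) (hpos : ∀ ω, 0 < P ω → 0 < q (f ω) ω)
    (hsum : ∀ ω, ∑ a, q a ω ≤ 1) (hconst : ∀ a ω ω', g ω = g ω' → q a ω = q a ω') :
    condEntropy P f g ≤ ∑ ω, P ω * -Real.log (q (f ω) ω) := by
  have key := sum_likelihood_ratio_le_one hP f g q hq hsum hconst
  rw [condEntropy_eq_sum, ← sub_nonpos, ← Finset.sum_sub_distrib]
  have hterm : ∀ ω ∈ Finset.univ,
      P ω * (Real.log (fiberProb P g ω) - Real.log (fiberProb P (fun ω => (f ω, g ω)) ω)) -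
        P ω * -Real.log (q (f ω) ω) ≤
      P ω * (fiberProb P g ω * q (f ω) ω / fiberProb P (fun ω => (f ω, g ω)) ω) - P ω := by
    intro ω _
    rcases (hP.1 ω).eq_or_lt with h | h
    · simp [← h]
    · have h1 := fiberProb_pos hP g h
      have h2 := fiberProb_pos hP (fun ω => (f ω, g ω)) h
      have h3 := hpos ω h
      have := Real.log_le_sub_one_of_pos (div_pos (mul_pos h1 h3) h2)
      rw [Real.log_div (mul_pos h1 h3).ne' h2.ne', Real.log_mul h1.ne' h3.ne'] at this
      nlinarith [mul_le_mul_of_nonneg_left this h.le]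
  refine (Finset.sum_le_sum hterm).trans ?_
  rw [Finset.sum_sub_distrib, hP.2]
  linarith

lemma condEntropy_le_log_card [Fintype α] [Nonempty α] (hP : P ∈ stdSimplex ℝ Ω) (f : Ω → α)
    (g : Ω → β) : condEntropy P f g ≤ Real.log (Fintype.card α) := by
  have hc : (0 : ℝ) < Fintype.card α := by exact_mod_cast Fintype.card_pos
  refine (condEntropy_le_of_kernel hP f g (fun _ _ => (Fintype.card α : ℝ)⁻¹)
    (fun _ _ => by positivity) (fun _ _ => by positivity) (fun _ => ?_) (fun _ _ _ _ => rfl)).trans ?_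
  · simp [hc.ne']
  · rw [← Finset.sum_mul, hP.2, Real.log_inv]
    simp

/-- Conditioning on a finer random variable does not increase the entropy. -/
lemma condEntropy_anti [Fintype α] (hP : P ∈ stdSimplex ℝ Ω) (f : Ω → α) {g : Ω → β} {g' : Ω → γ}
    (h : ∀ ω ω', g' ω = g' ω' → g ω = g ω') : condEntropy P f g' ≤ condEntropy P f g := by
  classical
  -- The kernel is the conditional law of `f` given the coarser variable `g`.
  refine (condEntropy_le_of_kernel hP f g'
    (fun a ω => (∑ ω', if f ω' = a ∧ g ω' = g ω then P ω' else 0) / fiberProb P g ω)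
    (fun a ω => ?_) (fun ω hω => ?_) (fun ω => ?_) (fun a ω ω' hω => ?_)).trans ?_
  · refine div_nonneg ?_ ?_ <;>
    · refine Finset.sum_nonneg fun ω' _ => ?_
      split_ifs
      exacts [hP.1 ω', le_rfl]
  · have := fiberProb_pos hP (fun ω => (f ω, g ω)) hω
    simp only [fiberProb, Prod.mk.injEq] at this
    exact div_pos this (fiberProb_pos hP g hω)
  · rw [← Finset.sum_div, Finset.sum_comm]
    have : ∀ ω', (∑ a, if f ω' = a ∧ g ω' = g ω then P ω' else 0) =
        if g ω' = g ω then P ω' else 0 := by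
      intro ω'
      by_cases h : g ω' = g ω <;> simp [h]
    simp only [this]
    exact div_self_le_one _
  · simp only [h _ _ hω, fiberProb]
  · rw [condEntropy_eq_sum]
    refine Finset.sum_le_sum fun ω _ => ?_
    rcases (hP.1 ω).eq_or_lt with h | h
    · simp [← h]
    · have h2 := fiberProb_pos hP (fun ω => (f ω, g ω)) h
      have h1 := fiberProb_pos hP g h
      have : (∑ ω', if f ω' = f ω ∧ g ω' = g ω then P ω' else 0) =
          fiberProb P (fun ω => (f ω, g ω)) ω := by
        simp only [fiberProb, Prod.mk.injEq]
      rw [this, Real.log_div h2.ne' h1.ne', neg_sub]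

open scoped Classical in
/-- Fano's inequality, in the weak form in which the binary entropy is bounded by `log 2`. -/
lemma condEntropy_le_of_decoder [Fintype α] [Nonempty α] (hP : P ∈ stdSimplex ℝ Ω) (f : Ω → α)
    (g : Ω → β) (d : Ω → α) (hd : ∀ ω ω', g ω = g ω' → d ω = d ω') :
    condEntropy P f g ≤
      Real.log 2 + (∑ ω, if d ω ≠ f ω then P ω else 0) * Real.log (Fintype.card α) := by
  have hc : (1 : ℝ) ≤ Fintype.card α := by exact_mod_cast Fintype.card_pos
  have hc0 : (0 : ℝ) < Fintype.card α := by linarith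
  -- The kernel mixes the decoder's guess with the uniform law in equal parts.
  refine (condEntropy_le_of_kernel hP f g
    (fun a ω => (if d ω = a then 1 / 2 else 0) + (2 * (Fintype.card α : ℝ))⁻¹)
    (fun a ω => ?_) (fun ω _ => ?_) (fun ω => ?_) (fun a ω ω' h => ?_)).trans ?_
  · split_ifs <;> positivity
  · split_ifs <;> positivity
  · rw [Finset.sum_add_distrib]
    simp only [Finset.sum_ite_eq, Finset.mem_univ, if_true, Finset.sum_const, Finset.card_univ,
      nsmul_eq_mul]
    field_simp
    norm_num
  · simp only [hd _ _ h]
  · have : Real.log 2 = ∑ ω, P ω * Real.log 2 := by rw [← Finset.sum_mul, hP.2, one_mul]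
    rw [this, Finset.sum_mul, ← Finset.sum_add_distrib]
    refine Finset.sum_le_sum fun ω _ => ?_
    by_cases h : d ω = f ω
    · simp only [h, if_true, ne_eq, not_true_eq_false, if_false, zero_mul, add_zero]
      refine mul_le_mul_of_nonneg_left ?_ (hP.1 ω)
      rw [← Real.log_inv]
      refine Real.log_le_log (by positivity) ?_
      rw [inv_le_comm₀ (by positivity) (by norm_num)]
      have : (0 : ℝ) < (2 * (Fintype.card α : ℝ))⁻¹ := by positivity
      linarith
    · simp only [h, if_false, ne_eq, not_false_eq_true, if_true, zero_add]
      rw [Real.log_inv, Real.log_mul (by norm_num) hc0.ne']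
      linarith

open scoped Classical in
/-- The entropy of an erased symbol. Let `B` be independent of `(Y, V)`, and let `U` reveal `B`, and
moreover `Y` when `B` lies in the set `E`. Then, with `p = P (B ∈ E)`,
`H(U, V) = H(B) + (1 - p) H(V) + p H(Y, V)`. -/
lemma entropy_erased {A δ : Type*} (hP : P ∈ stdSimplex ℝ Ω) (B : Ω → A) (E : Set A)
    (Y : Ω → α) (V : Ω → β) (U : Ω → δ) (p : ℝ)
    (hU : ∀ ω ω', U ω' = U ω ↔ B ω' = B ω ∧ (B ω ∈ E → Y ω' = Y ω))
    (hp : p = ∑ ω, P ω * if B ω ∈ E then 1 else 0)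
    (hind : ∀ (φ : Ω → ℝ) (ψ : A → ℝ), (∀ ω ω', Y ω = Y ω' → V ω = V ω' → φ ω = φ ω') →
      ∑ ω, P ω * (φ ω * ψ (B ω)) = (∑ ω, P ω * φ ω) * ∑ ω, P ω * ψ (B ω)) :
    entropy P (fun ω => (U ω, V ω)) =
      entropy P B + (1 - p) * entropy P V + p * entropy P (fun ω => (Y ω, V ω)) := by
  have hfib : ∀ ω, fiberProb P (fun ω => (U ω, V ω)) ω = fiberProb P B ω *
      if B ω ∈ E then fiberProb P (fun ω => (Y ω, V ω)) ω else fiberProb P V ω := by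
    intro ω
    have hB : fiberProb P B ω = ∑ ω', P ω' * if B ω' = B ω then 1 else 0 := by
      simp [fiberProb]
    by_cases h : B ω ∈ E
    · have := hind (fun ω' => if Y ω' = Y ω ∧ V ω' = V ω then 1 else 0)
        (fun b => if b = B ω then 1 else 0) (fun ω₁ ω₂ h1 h2 => by simp only [h1, h2])
      rw [if_pos h, hB, mul_comm]
      refine Eq.trans ?_ (this.trans ?_)
      · refine Finset.sum_congr rfl fun ω' _ => ?_
        simp only [Prod.mk.injEq, hU, h, forall_const]
        by_cases h1 : B ω' = B ω <;> by_cases h2 : Y ω' = Y ω <;> by_cases h3 : V ω' = V ω <;>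
          simp [h1, h2, h3]
      · simp [fiberProb]
    · have := hind (fun ω' => if V ω' = V ω then 1 else 0)
        (fun b => if b = B ω then 1 else 0) (fun ω₁ ω₂ h1 h2 => by simp only [h2])
      rw [if_neg h, hB, mul_comm]
      refine Eq.trans ?_ (this.trans ?_)
      · refine Finset.sum_congr rfl fun ω' _ => ?_
        simp only [Prod.mk.injEq, hU, h, false_imp_iff, and_true]
        by_cases h1 : B ω' = B ω <;> by_cases h3 : V ω' = V ω <;> simp [h1, h3]
      · simp [fiberProb]
  have hY := hind (fun ω => Real.log (fiberProb P (fun ω => (Y ω, V ω)) ω))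
    (fun b => if b ∈ E then 1 else 0) (fun ω ω' h1 h2 =>
      congrArg Real.log (fiberProb_congr (f := fun ω => (Y ω, V ω)) (Prod.ext h1 h2)))
  have hV := hind (fun ω => Real.log (fiberProb P V ω))
    (fun b => if b ∈ E then 0 else 1) (fun ω ω' _ h2 =>
      congrArg Real.log (fiberProb_congr (f := V) h2))
  have hp' : 1 - p = ∑ ω, P ω * if B ω ∈ E then 0 else 1 := by
    rw [hp, sub_eq_iff_eq_add, ← Finset.sum_add_distrib]
    refine hP.2.symm.trans (Finset.sum_congr rfl fun ω _ => ?_)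
    split_ifs <;> simp
  rw [← hp] at hY
  rw [← hp'] at hV
  have hlog : ∀ ω, P ω * Real.log (fiberProb P (fun ω => (U ω, V ω)) ω) =
      P ω * Real.log (fiberProb P B ω) +
      P ω * (Real.log (fiberProb P (fun ω => (Y ω, V ω)) ω) * if B ω ∈ E then 1 else 0) +
      P ω * (Real.log (fiberProb P V ω) * if B ω ∈ E then 0 else 1) := by
    intro ω
    rcases (hP.1 ω).eq_or_lt with h | h
    · simp [← h]
    · rw [hfib, Real.log_mul (fiberProb_pos hP B h).ne']
      · split_ifs <;> ring
      · split_ifs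
        exacts [(fiberProb_pos hP _ h).ne', (fiberProb_pos hP V h).ne']
  simp only [entropy, hlog, Finset.sum_add_distrib, hY, hV]
  ring

end

end FiniteEntropy

namespace BroadcastErasure

open FiniteEntropy

section

variable {K n : ℕ} {m : Fin K → ℕ} {F : Type}

/-! ### The sample space of messages and reception sets -/

/-- The sample space of a code of length `n`: the messages, and for each slot the set of receivers
that obtain the transmitted symbol. These data determine all channel inputs and outputs. -/
abbrev Sample (K n : ℕ) (m : Fin K → ℕ) (F : Type) : Type :=
  Messages m F × (Fin n → Finset (Fin K))

/-- The law of a sample: the messages are uniform, and the reception sets are independent of the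
messages and of each other, each with law `W.p`. -/
noncomputable def sampleWeight [Fintype F] (W : PEC K) (ω : Sample K n m F) : ℝ :=
  (Fintype.card (Messages m F) : ℝ)⁻¹ * ∏ t, W.p (ω.2 t)

/-- The channel outputs produced by the code from the messages `x` and the reception sets `s`,
by recursion on the slot. -/
noncomputable def FeedbackCode.output (C : FeedbackCode n m F) (x : Messages m F)
    (s : Fin n → Finset (Fin K)) (t : Fin n) : Output K F :=
  fun k => if k ∈ s t then
    some (C.enc t x fun τ => C.output x s ⟨τ, τ.isLt.trans t.isLt⟩) else none
termination_by t.val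
decreasing_by exact τ.isLt

/-- The symbol sent in slot `t`. -/
noncomputable def FeedbackCode.sent (C : FeedbackCode n m F) (t : Fin n) (ω : Sample K n m F) : F :=
  C.enc t ω.1 fun τ => C.output ω.1 ω.2 ⟨τ, τ.isLt.trans t.isLt⟩

lemma FeedbackCode.output_apply (C : FeedbackCode n m F) (ω : Sample K n m F) (t : Fin n)
    (k : Fin K) : C.output ω.1 ω.2 t k = if k ∈ ω.2 t then some (C.sent t ω) else none := by
  rw [FeedbackCode.output]
  rfl

lemma FeedbackCode.output_congr (C : FeedbackCode n m F) (x : Messages m F)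
    (s s' : Fin n → Finset (Fin K)) (N : ℕ) (h : ∀ τ : Fin n, τ.val < N → s τ = s' τ) :
    ∀ t : Fin n, t.val < N → C.output x s t = C.output x s' t := by
  intro t
  induction t using WellFoundedLT.induction with
  | ind t ih =>
    intro ht
    funext k
    rw [C.output_apply (x, s), C.output_apply (x, s')]
    have : C.sent t (x, s) = C.sent t (x, s') := by
      unfold FeedbackCode.sent
      congr 1
      funext τ
      exact ih ⟨τ, τ.isLt.trans t.isLt⟩ τ.isLt (τ.isLt.trans ht)
    exact if_congr (by change k ∈ s t ↔ k ∈ s' t; rw [h t ht]) (by rw [this]) rfl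

lemma FeedbackCode.sent_congr (C : FeedbackCode n m F) (x : Messages m F)
    (s s' : Fin n → Finset (Fin K)) (t : Fin n) (h : ∀ τ : Fin n, τ < t → s τ = s' τ) :
    C.sent t (x, s) = C.sent t (x, s') := by
  unfold FeedbackCode.sent
  congr 1
  funext τ
  exact C.output_congr x s s' t h _ τ.isLt

lemma sampleWeight_mem_stdSimplex [Fintype F] [Nonempty F] (W : PEC K) :
    (sampleWeight W : Sample K n m F → ℝ) ∈ stdSimplex ℝ (Sample K n m F) := by
  refine ⟨fun ω => mul_nonneg (by positivity) (Finset.prod_nonneg fun t _ => W.p_nonneg _), ?_⟩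
  have h1 : ∑ s : Fin n → Finset (Fin K), ∏ t, W.p (s t) = 1 := by
    have := Finset.prod_univ_sum (fun _ : Fin n => (Finset.univ : Finset (Finset (Fin K))))
      (fun _ S => W.p S)
    rw [Fintype.piFinset_univ] at this
    rw [← this]
    simp [W.p_sum]
  simp only [sampleWeight, Fintype.sum_prod_type, ← Finset.mul_sum, h1]
  rw [Finset.sum_const, Finset.card_univ, nsmul_eq_mul, mul_one,
    inv_mul_cancel₀ (by exact_mod_cast Fintype.card_ne_zero)]

/-- Exchanging the reception set of slot `t` with an independent copy of it preserves the law. -/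
lemma sampleWeight_update_mul [Fintype F] (W : PEC K) (t : Fin n) (x : Messages m F)
    (s : Fin n → Finset (Fin K)) (S : Finset (Fin K)) :
    sampleWeight W (x, Function.update s t S) * W.p (s t) = sampleWeight W (x, s) * W.p S := by
  have h1 : ∏ τ, W.p (Function.update s t S τ) = W.p S * ∏ τ ∈ Finset.univ \ {t}, W.p (s τ) := by
    have := Finset.prod_update_of_mem (Finset.mem_univ t) (fun τ => W.p (s τ)) (W.p S)
    rw [← this]
    refine Finset.prod_congr rfl fun τ _ => ?_
    by_cases h : τ = t
    · subst h; simp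
    · simp [h]
  have h2 := Finset.prod_eq_mul_prod_sdiff_singleton_of_mem (Finset.mem_univ t)
    (fun τ => W.p (s τ))
  simp only [sampleWeight, h1, h2]
  ring

/-- The reception set of slot `t` has law `W.p` and is independent of everything that the other
slots and the messages determine. -/
lemma sum_sampleWeight_mul [Fintype F] (W : PEC K) (t : Fin n) (φ : Sample K n m F → ℝ)
    (ψ : Finset (Fin K) → ℝ) (hφ : ∀ x s S, φ (x, Function.update s t S) = φ (x, s)) :
    ∑ ω, sampleWeight W ω * (φ ω * ψ (ω.2 t)) =
      (∑ ω, sampleWeight W ω * φ ω) * ∑ S, W.p S * ψ S := by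
  let swap : Sample K n m F × Finset (Fin K) → Sample K n m F × Finset (Fin K) :=
    fun a => ((a.1.1, Function.update a.1.2 t a.2), a.1.2 t)
  have hswap : Function.Involutive swap := fun a => by simp [swap]
  calc ∑ ω, sampleWeight W ω * (φ ω * ψ (ω.2 t))
      = ∑ a : Sample K n m F × Finset (Fin K),
          sampleWeight W a.1 * (φ a.1 * ψ (a.1.2 t)) * W.p a.2 := by
        simp only [Fintype.sum_prod_type (α₁ := Sample K n m F), ← Finset.mul_sum, W.p_sum, mul_one]
    _ = ∑ a : Sample K n m F × Finset (Fin K),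
          sampleWeight W a.1 * φ a.1 * (W.p a.2 * ψ a.2) := by
        refine Fintype.sum_bijective swap hswap.bijective _ _ fun a => ?_
        obtain ⟨⟨x, s⟩, S⟩ := a
        simp only [swap, hφ]
        linear_combination (-(φ (x, s) * ψ (s t))) * sampleWeight_update_mul W t x s S
    _ = _ := by
        simp only [Fintype.sum_prod_type (α₁ := Sample K n m F), ← Finset.mul_sum, Finset.sum_mul]

lemma sum_sampleWeight_reception [Fintype F] [Nonempty F] (W : PEC K) (t : Fin n)
    (ψ : Finset (Fin K) → ℝ) :
    ∑ ω : Sample K n m F, sampleWeight W ω * ψ (ω.2 t) = ∑ S, W.p S * ψ S := by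
  have := sum_sampleWeight_mul (F := F) (m := m) W t (fun _ => 1) ψ (fun _ _ _ => rfl)
  simpa [(sampleWeight_mem_stdSimplex (F := F) (m := m) (n := n) W).2] using this

/-! ### The law of the channel outputs -/

lemma FeedbackCode.output_injective (C : FeedbackCode n m F) (x : Messages m F) :
    Function.Injective (C.output x) := by
  intro s s' h
  funext t
  ext k
  have := congrFun (congrFun h t) k
  rw [C.output_apply (x, s), C.output_apply (x, s')] at this
  by_cases h1 : k ∈ s t <;> by_cases h2 : k ∈ s' t <;> simp_all

lemma FeedbackCode.transition_output (C : FeedbackCode n m F) (W : PEC K) (x : Messages m F)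
    (s : Fin n → Finset (Fin K)) (t : Fin n) :
    W.transition (C.enc t x fun τ => C.output x s ⟨τ, τ.isLt.trans t.isLt⟩) (C.output x s t) =
      W.p (s t) := by
  change W.transition (C.sent t (x, s)) (C.output x s t) = _
  have h := C.output_apply (x, s) t
  dsimp only at h
  rw [PEC.transition, if_pos]
  · congr 1
    ext k
    simp [h k]
  · intro k
    rw [h k]
    split_ifs <;> simp

/-- The joint law of messages and outputs is the image of the law of the sample. -/
lemma FeedbackCode.sum_jointProb [Fintype F] (C : FeedbackCode n m F) (W : PEC K)
    (x : Messages m F) (g : (Fin n → Output K F) → ℝ) :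
    ∑ z, g z * C.jointProb W x z = ∑ s, g (C.output x s) * sampleWeight W (x, s) := by
  symm
  refine Finset.sum_of_injOn (C.output x) (C.output_injective x).injOn (by simp) ?_ ?_
  · intro z _ hz
    -- An output sequence of positive probability is produced by its own reception sets.
    by_contra hne
    have hne' : ∀ t, W.transition (C.enc t x fun τ => z ⟨τ, τ.isLt.trans t.isLt⟩) (z t) ≠ 0 := by
      intro t ht
      apply hne
      rw [FeedbackCode.jointProb, Finset.prod_eq_zero (Finset.mem_univ t) ht]
      simp
    apply hz
    classical
    let s : Fin n → Finset (Fin K) := fun t => {k | z t k ≠ none}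
    refine ⟨s, by simp, ?_⟩
    funext t
    induction t using WellFoundedLT.induction with
    | ind t ih =>
      have hsent : C.sent t (x, s) = C.enc t x fun τ => z ⟨τ, τ.isLt.trans t.isLt⟩ := by
        unfold FeedbackCode.sent
        congr 1
        funext τ
        exact ih ⟨τ, τ.isLt.trans t.isLt⟩ τ.isLt
      have ht := hne' t
      rw [PEC.transition] at ht
      have hz' := (ite_ne_right_iff.1 ht).1
      funext k
      rw [C.output_apply (x, s), hsent]
      rcases hz' k with h | h <;> simp [s, h]
  · intro s _
    simp only [FeedbackCode.jointProb, sampleWeight, C.transition_output]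

open scoped Classical in
lemma FeedbackCode.errorProb_eq [Fintype F] (C : FeedbackCode n m F) (W : PEC K) (k : Fin K) :
    C.errorProb W k = ∑ ω : Sample K n m F,
      if C.dec k (fun t => C.output ω.1 ω.2 t k) ≠ ω.1 k then sampleWeight W ω else 0 := by
  rw [Fintype.sum_prod_type, FeedbackCode.errorProb]
  refine Finset.sum_congr rfl fun x _ => ?_
  have := C.sum_jointProb W x (fun z => if C.dec k (fun t => z t k) ≠ x k then 1 else 0)
  simpa only [ite_mul, one_mul, zero_mul] using this

/-! ### Growth of the receivers' information -/

open scoped Classical in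
/-- What is known when the messages of the sessions in `M`, and the outputs of the receivers in `T`
during the first `t` slots, are known; unknown data are replaced by `none`. -/
noncomputable def FeedbackCode.history (C : FeedbackCode n m F) (T M : Finset (Fin K)) (t : ℕ)
    (ω : Sample K n m F) :
    ((k : Fin K) → Option (Fin (m k) → F)) × (Fin n → Fin K → Option (Option F)) :=
  (fun k => if k ∈ M then some (ω.1 k) else none,
    fun τ k => if τ.val < t ∧ k ∈ T then some (C.output ω.1 ω.2 τ k) else none)

lemma FeedbackCode.history_eq_iff (C : FeedbackCode n m F) (T M : Finset (Fin K)) (t : ℕ)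
    (ω ω' : Sample K n m F) : C.history T M t ω = C.history T M t ω' ↔
      (∀ k ∈ M, ω.1 k = ω'.1 k) ∧
        ∀ τ : Fin n, τ.val < t → ∀ k ∈ T, C.output ω.1 ω.2 τ k = C.output ω'.1 ω'.2 τ k := by
  simp only [FeedbackCode.history, Prod.mk.injEq, funext_iff]
  refine and_congr (forall_congr' fun k => ?_) (forall_congr' fun τ => ?_)
  · by_cases h : k ∈ M <;> simp [h, funext_iff]
  · by_cases h : τ.val < t
    · simp only [h, true_and, forall_const]
      refine forall_congr' fun k => ?_
      by_cases h : k ∈ T <;> simp [h]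
    · simp [h]

lemma FeedbackCode.entropy_message_history [Fintype F] (C : FeedbackCode n m F) (W : PEC K)
    (T M : Finset (Fin K)) (t : ℕ) (k : Fin K) :
    entropy (sampleWeight W) (fun ω => (ω.1 k, C.history T M t ω)) =
      entropy (sampleWeight W) (C.history T (insert k M) t) := by
  refine entropy_congr fun ω ω' => ?_
  simp only [Prod.mk.injEq, C.history_eq_iff, Finset.forall_mem_insert, and_assoc]

/-- The entropy gained by the receivers in `T` in slot `t`: that of the part of the reception set
they see, plus the uncertainty about the sent symbol times the probability that one of them
obtains it. -/
lemma FeedbackCode.entropy_history_succ [Fintype F] [Nonempty F] (C : FeedbackCode n m F)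
    (W : PEC K) (T M : Finset (Fin K)) (t : Fin n) :
    entropy (sampleWeight W) (C.history T M (t + 1)) - entropy (sampleWeight W) (C.history T M t) =
      entropy (sampleWeight W) (fun ω : Sample K n m F => ω.2 t ∩ T) +
        W.pUnion T * condEntropy (sampleWeight W) (C.sent t) (C.history T M t) := by
  classical
  let U : Sample K n m F → Fin K → Option (Option F) :=
    fun ω k => if k ∈ T then some (C.output ω.1 ω.2 t k) else none
  have h1 : entropy (sampleWeight W) (C.history T M (t + 1)) =
      entropy (sampleWeight W) (fun ω => (U ω, C.history T M t ω)) := by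
    refine entropy_congr fun ω ω' => ?_
    have hU : U ω' = U ω ↔ ∀ k ∈ T, C.output ω'.1 ω'.2 t k = C.output ω.1 ω.2 t k := by
      simp only [U, funext_iff]
      refine forall_congr' fun k => ?_
      by_cases h : k ∈ T <;> simp [h]
    simp only [Prod.mk.injEq, C.history_eq_iff, hU, Nat.lt_succ_iff_lt_or_eq]
    constructor
    · rintro ⟨h1, h2⟩
      exact ⟨h2 t (Or.inr rfl), h1, fun τ hτ => h2 τ (Or.inl hτ)⟩
    · rintro ⟨h1, h2, h3⟩
      refine ⟨h2, fun τ hτ => ?_⟩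
      rcases hτ with hτ | hτ
      · exact h3 τ hτ
      · rw [Fin.ext hτ]; exact h1
  have h2 := entropy_erased (sampleWeight_mem_stdSimplex W) (fun ω : Sample K n m F => ω.2 t ∩ T)
    {S | S.Nonempty} (C.sent t) (C.history T M t) U (W.pUnion T) ?_ ?_ ?_
  · rw [h1, h2, condEntropy]
    ring
  · intro ω ω'
    simp only [U, funext_iff, Finset.ext_iff, Set.mem_ofPred_eq, Finset.mem_inter]
    constructor
    · intro h
      refine ⟨fun k => ?_, ?_⟩
      · have := h k
        simp only [C.output_apply] at this
        by_cases hT : k ∈ T <;> by_cases hk : k ∈ ω.2 t <;> by_cases hk' : k ∈ ω'.2 t <;> simp_all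
      · rintro ⟨k, hk⟩
        rw [Finset.mem_inter] at hk
        have := h k
        simp only [C.output_apply] at this
        by_cases hk' : k ∈ ω'.2 t <;> simp_all
    · rintro ⟨h1, h2⟩ k
      have := h1 k
      simp only [C.output_apply]
      by_cases hT : k ∈ T
      · simp only [hT, and_true, if_true] at this ⊢
        by_cases hk : k ∈ ω.2 t
        · rw [if_pos hk, if_pos (this.2 hk), h2 ⟨k, by simp [hk, hT]⟩]
        · rw [if_neg hk, if_neg (fun h => hk (this.1 h))]
      · simp [hT]
  · rw [sum_sampleWeight_reception W t (fun S => @ite ℝ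
      (S ∩ T ∈ {S : Finset (Fin K) | S.Nonempty}) (Classical.propDecidable _) 1 0)]
    simp only [PEC.pUnion, Finset.sum_filter, mul_ite, mul_one, mul_zero]
    exact Finset.sum_congr rfl fun S _ => if_congr Iff.rfl rfl rfl
  · intro φ ψ hφ
    have h3 := sum_sampleWeight_mul W t φ (fun S => ψ (S ∩ T)) fun x s S => by
      have hs : ∀ τ : Fin n, τ < t → Function.update s t S τ = s τ :=
        fun τ hτ => Function.update_of_ne hτ.ne _ _
      refine hφ _ _ (C.sent_congr x _ _ t hs) ?_
      rw [C.history_eq_iff]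
      refine ⟨fun _ _ => rfl, fun τ hτ k _ => ?_⟩
      exact congrFun (C.output_congr x _ _ t hs τ hτ) k
    rw [h3, sum_sampleWeight_reception W t (fun S => ψ (S ∩ T))]

lemma FeedbackCode.entropy_history_zero [Fintype F] [Nonempty F] (C : FeedbackCode n m F)
    (W : PEC K) (T M : Finset (Fin K)) :
    entropy (sampleWeight W) (C.history T M 0) =
      (∑ k ∈ M, (m k : ℝ)) * Real.log (Fintype.card F) := by
  classical
  have hF : (0 : ℝ) < Fintype.card F := by exact_mod_cast Fintype.card_pos
  have hsimplex := sampleWeight_mem_stdSimplex (F := F) (m := m) (n := n) W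
  have hfib : ∀ ω : Sample K n m F,
      fiberProb (sampleWeight W) (C.history T M 0) ω = ∏ k ∈ M, ((Fintype.card F : ℝ) ^ m k)⁻¹ := by
    intro ω
    have hs : ∀ x : Messages m F, ∑ s : Fin n → Finset (Fin K), sampleWeight W (x, s) =
        (Fintype.card (Messages m F) : ℝ)⁻¹ := by
      have h1 := hsimplex.2
      rw [Fintype.sum_prod_type] at h1
      have h2 : ∀ x y : Messages m F, ∑ s : Fin n → Finset (Fin K), sampleWeight W (x, s) =
        ∑ s : Fin n → Finset (Fin K), sampleWeight W (y, s) := fun x y => rfl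
      intro x
      rw [Finset.sum_congr rfl (fun y _ => h2 y x)] at h1
      rw [Finset.sum_const, nsmul_eq_mul, Finset.card_univ] at h1
      exact eq_inv_of_mul_eq_one_right h1
    have hcount : ∑ x : Messages m F, (if ∀ k ∈ M, x k = ω.1 k then (1 : ℝ) else 0) =
        ∏ k, if k ∈ M then 1 else (Fintype.card F : ℝ) ^ m k := by
      rw [← Finset.sum_filter, Finset.sum_const, nsmul_eq_mul, mul_one]
      have : (Finset.univ.filter fun x : Messages m F => ∀ k ∈ M, x k = ω.1 k) =
          Fintype.piFinset fun k => if k ∈ M then {ω.1 k} else Finset.univ := by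
        ext x
        simp only [Finset.mem_filter, Finset.mem_univ, true_and, Fintype.mem_piFinset]
        refine forall_congr' fun k => ?_
        by_cases h : k ∈ M <;> simp [h]
      rw [this, Fintype.card_piFinset, Nat.cast_prod]
      refine Finset.prod_congr rfl fun k _ => ?_
      by_cases h : k ∈ M <;> simp [h]
    have hcard : (Fintype.card (Messages m F) : ℝ) = ∏ k, (Fintype.card F : ℝ) ^ m k := by
      rw [Fintype.card_pi, Nat.cast_prod]
      simp
    unfold fiberProb
    simp only [C.history_eq_iff, Nat.not_lt_zero, false_imp_iff, implies_true, and_true]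
    rw [Fintype.sum_prod_type]
    have : ∀ x : Messages m F, ∑ s : Fin n → Finset (Fin K),
        (if ∀ k ∈ M, x k = ω.1 k then sampleWeight W (x, s) else 0) =
        (if ∀ k ∈ M, x k = ω.1 k then (1 : ℝ) else 0) * (Fintype.card (Messages m F) : ℝ)⁻¹ := by
      intro x
      split_ifs
      · rw [one_mul, hs]
      · simp
    refine Eq.trans (Finset.sum_congr rfl fun x _ => (Eq.trans ?_ (this x))) ?_
    · exact Finset.sum_congr rfl fun s _ => if_congr Iff.rfl rfl rfl
    rw [← Finset.sum_mul, hcount, hcard, ← Finset.prod_inv_distrib, ← Finset.prod_mul_distrib,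
      ← Finset.prod_subset (Finset.subset_univ M)]
    · exact Finset.prod_congr rfl fun k hk => by rw [if_pos hk, one_mul]
    · intro k _ hk
      rw [if_neg hk, mul_inv_cancel₀ (by positivity)]
  simp only [entropy, hfib]
  rw [← Finset.sum_mul, hsimplex.2, one_mul, Real.log_prod (fun k _ => by positivity),
    Finset.sum_mul, ← Finset.sum_neg_distrib]
  refine Finset.sum_congr rfl fun k _ => ?_
  rw [Real.log_inv, Real.log_pow, neg_neg]

lemma FeedbackCode.entropy_history_length_le [Fintype F] [Nonempty F] (C : FeedbackCode n m F)
    (W : PEC K) (T M : Finset (Fin K)) {k : Fin K} (hk : k ∈ T) :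
    entropy (sampleWeight W) (C.history T (insert k M) n) -
        entropy (sampleWeight W) (C.history T M n) ≤
      Real.log 2 + C.errorProb W k * (m k * Real.log (Fintype.card F)) := by
  classical
  have := condEntropy_le_of_decoder (sampleWeight_mem_stdSimplex W)
    (fun ω : Sample K n m F => ω.1 k) (C.history T M n)
    (fun ω => C.dec k (fun t => C.output ω.1 ω.2 t k)) (fun ω ω' h => by
      rw [C.history_eq_iff] at h
      congr 1
      funext t
      exact h.2 t t.isLt k hk)
  rw [condEntropy, C.entropy_message_history] at this
  rw [C.errorProb_eq, sub_le_iff_le_add]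
  rw [sub_le_iff_le_add] at this
  refine this.trans_eq ?_
  rw [Fintype.card_fun, Fintype.card_fin, Nat.cast_pow, Real.log_pow]
  congr!

/-- The single-session converse: the session of a receiver `k ∈ T` whose message is not yet in `M`
is limited by the information about the sent symbols that its message carries, discounted by the
probability that `T` obtains a symbol. -/
lemma FeedbackCode.message_le [Fintype F] [Nonempty F] (C : FeedbackCode n m F) (W : PEC K)
    (T M : Finset (Fin K)) {k : Fin K} (hk : k ∈ T) (hM : k ∉ M) :
    m k * Real.log (Fintype.card F) -
        (Real.log 2 + C.errorProb W k * (m k * Real.log (Fintype.card F))) ≤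
      W.pUnion T * ∑ t, (condEntropy (sampleWeight W) (C.sent t) (C.history T M t) -
        condEntropy (sampleWeight W) (C.sent t) (C.history T (insert k M) t)) := by
  have htel : ∀ f : ℕ → ℝ, ∑ t : Fin n, (f (t + 1) - f t) = f n - f 0 := fun f => by
    rw [Fin.sum_univ_eq_sum_range (fun t => f (t + 1) - f t) n, Finset.sum_range_sub]
  have hA := htel fun t => entropy (sampleWeight W) (C.history T M t)
  have hB := htel fun t => entropy (sampleWeight W) (C.history T (insert k M) t)
  simp only [C.entropy_history_succ, Finset.sum_add_distrib, ← Finset.mul_sum,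
    C.entropy_history_zero] at hA hB
  rw [Finset.sum_insert hM] at hB
  have hlast := C.entropy_history_length_le W T M hk
  rw [Finset.sum_sub_distrib, mul_sub]
  linarith

/-! ### Telescoping along the order of the receivers -/

/-- The set of the first `i` receivers in the order `π`, for `0 ≤ i ≤ K`. -/
def receiverPrefix (π : Equiv.Perm (Fin K)) (i : ℕ) : Finset (Fin K) :=
  (Finset.univ.filter fun j : Fin K => j.val < i).image π

lemma mem_receiverPrefix {π : Equiv.Perm (Fin K)} {i : ℕ} {k : Fin K} :
    k ∈ receiverPrefix π i ↔ (π.symm k).val < i := by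
  simp only [receiverPrefix, Finset.mem_image, Finset.mem_filter, Finset.mem_univ, true_and]
  constructor
  · rintro ⟨j, hj, rfl⟩
    simpa using hj
  · exact fun h => ⟨_, h, by simp⟩

lemma firstReceivers_eq (π : Equiv.Perm (Fin K)) (j : Fin K) :
    firstReceivers π j = receiverPrefix π (j + 1) := by
  unfold firstReceivers receiverPrefix
  congr 1
  ext i
  simp only [Finset.mem_Iic, Finset.mem_filter, Finset.mem_univ, true_and, Fin.le_def]
  omega

lemma insert_receiverPrefix (π : Equiv.Perm (Fin K)) (j : Fin K) :
    insert (π j) (receiverPrefix π j) = receiverPrefix π (j + 1) := by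
  ext k
  rw [Finset.mem_insert, mem_receiverPrefix, mem_receiverPrefix, Nat.lt_succ_iff_lt_or_eq,
    or_comm, ← Equiv.symm_apply_eq, Fin.ext_iff]

lemma FeedbackCode.condEntropy_history_anti [Fintype F] [Nonempty F] (C : FeedbackCode n m F)
    (W : PEC K) (t : Fin n) {T T' M M' : Finset (Fin K)} (hT : T ⊆ T') (hM : M ⊆ M') :
    condEntropy (sampleWeight W) (C.sent t) (C.history T' M' t) ≤
      condEntropy (sampleWeight W) (C.sent t) (C.history T M t) := by
  refine condEntropy_anti (sampleWeight_mem_stdSimplex W) _ fun ω ω' h => ?_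
  rw [C.history_eq_iff] at h ⊢
  exact ⟨fun k hk => h.1 k (hM hk), fun τ hτ k hk => h.2 τ hτ k (hT hk)⟩

/-- The information about the sent symbols, summed over the slots, that the `j`-th message in the
order `π` carries once the earlier messages and the past outputs of the first receivers, up to the
`j`-th one, are known. -/
noncomputable def FeedbackCode.information [Fintype F] (C : FeedbackCode n m F) (W : PEC K)
    (π : Equiv.Perm (Fin K)) (j : Fin K) : ℝ :=
  ∑ t, (condEntropy (sampleWeight W) (C.sent t)
      (C.history (firstReceivers π j) (receiverPrefix π j) t) -
    condEntropy (sampleWeight W) (C.sent t)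
      (C.history (firstReceivers π j) (receiverPrefix π (j + 1)) t))

lemma FeedbackCode.information_nonneg [Fintype F] [Nonempty F] (C : FeedbackCode n m F)
    (W : PEC K) (π : Equiv.Perm (Fin K)) (j : Fin K) : 0 ≤ C.information W π j := by
  refine Finset.sum_nonneg fun t _ => sub_nonneg.2 ?_
  refine C.condEntropy_history_anti W t subset_rfl ?_
  rw [← insert_receiverPrefix]
  exact Finset.subset_insert _ _

/-- The messages share `log |F|` nats per slot. Discarding the observations of the `j`-th receiver
in the first term of each difference makes the sum over `j` telescope. -/
lemma FeedbackCode.sum_information_le [Fintype F] [Nonempty F] (C : FeedbackCode n m F)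
    (W : PEC K) (π : Equiv.Perm (Fin K)) :
    ∑ j, C.information W π j ≤ n * Real.log (Fintype.card F) := by
  let G : Fin n → ℕ → ℝ := fun t i =>
    condEntropy (sampleWeight W) (C.sent t) (C.history (receiverPrefix π i) (receiverPrefix π i) t)
  have hstep : ∀ j : Fin K, C.information W π j ≤ ∑ t, (G t j - G t (j + 1)) := by
    intro j
    refine Finset.sum_le_sum fun t _ => ?_
    simp only [G, firstReceivers_eq]
    refine sub_le_sub_right (C.condEntropy_history_anti W t ?_ subset_rfl) _
    rw [← insert_receiverPrefix]
    exact Finset.subset_insert _ _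
  refine (Finset.sum_le_sum fun j _ => hstep j).trans ?_
  rw [Finset.sum_comm]
  have hslot : ∀ t ∈ Finset.univ, ∑ j : Fin K, (G t j - G t (j + 1)) ≤
      Real.log (Fintype.card F) := by
    intro t _
    rw [Fin.sum_univ_eq_sum_range (fun j => G t j - G t (j + 1)) K, Finset.sum_range_sub']
    have h0 : G t 0 ≤ Real.log (Fintype.card F) :=
      condEntropy_le_log_card (sampleWeight_mem_stdSimplex W) _ _
    have hK : 0 ≤ G t K := condEntropy_nonneg (sampleWeight_mem_stdSimplex W) _ _
    linarith
  refine (Finset.sum_le_sum hslot).trans ?_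
  simp

/-- The converse for a single session. Here `log |F| ≥ log 2` absorbs the constant of Fano's
inequality, uniformly in the field. -/
lemma FeedbackCode.message_le_information [Field F] [Fintype F] (C : FeedbackCode n m F)
    (W : PEC K) (π : Equiv.Perm (Fin K)) {ε : ℝ} (hε : ∀ k, C.errorProb W k ≤ ε) (j : Fin K) :
    ((1 - ε) * m (π j) - 1) * Real.log (Fintype.card F) ≤
      W.pUnion (firstReceivers π j) * C.information W π j := by
  have h := C.message_le W (firstReceivers π j) (receiverPrefix π j) (k := π j)
    (by simp [firstReceivers]) (by simp [mem_receiverPrefix])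
  rw [insert_receiverPrefix] at h
  refine le_trans ?_ h
  have h2 : Real.log 2 ≤ Real.log (Fintype.card F) :=
    Real.log_le_log (by norm_num) (by exact_mod_cast Fintype.one_lt_card (α := F))
  have h3 : 0 ≤ m (π j) * Real.log (Fintype.card F) := by positivity
  nlinarith [mul_le_mul_of_nonneg_right (hε (π j)) h3]

lemma PEC.pUnion_nonneg (W : PEC K) (S : Finset (Fin K)) : 0 ≤ W.pUnion S :=
  Finset.sum_nonneg fun _ _ => W.p_nonneg _

lemma log_card_pos (F : Type) [Field F] [Fintype F] : 0 < Real.log (Fintype.card F) :=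
  Real.log_pos (by exact_mod_cast Fintype.one_lt_card)

/-- The finite-length converse. Sessions with `p_{∪S} = 0` contribute `0` to the left-hand side,
since division by zero yields zero. -/
lemma FeedbackCode.sum_message_div_le [Field F] [Fintype F] (C : FeedbackCode n m F)
    (W : PEC K) (π : Equiv.Perm (Fin K)) {ε : ℝ} (hε : ∀ k, C.errorProb W k ≤ ε) :
    ∑ j, ((1 - ε) * m (π j) - 1) / W.pUnion (firstReceivers π j) ≤ n := by
  have hL := log_card_pos F
  refine le_of_mul_le_mul_right ?_ hL
  refine le_trans ?_ (C.sum_information_le W π)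
  rw [Finset.sum_mul]
  refine Finset.sum_le_sum fun j _ => ?_
  rcases (W.pUnion_nonneg (firstReceivers π j)).eq_or_lt with h | h
  · simpa [← h] using C.information_nonneg W π j
  · rw [div_mul_eq_mul_div, div_le_iff₀' h]
    exact C.message_le_information W π hε j

/-- A session whose receiver never obtains anything, and neither do those before it, carries a
bounded number of symbols. -/
lemma FeedbackCode.message_le_one_of_pUnion_eq_zero [Field F] [Fintype F] (C : FeedbackCode n m F)
    (W : PEC K) (π : Equiv.Perm (Fin K)) {ε : ℝ} (hε : ∀ k, C.errorProb W k ≤ ε) {j : Fin K}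
    (hj : W.pUnion (firstReceivers π j) = 0) : (1 - ε) * m (π j) ≤ 1 := by
  have h := C.message_le_information W π hε j
  rw [hj, zero_mul] at h
  have := nonpos_of_mul_nonpos_left h (log_card_pos F)
  linarith

/-! ### The asymptotic bounds -/

lemma Achievable.eq_zero_of_pUnion_eq_zero {W : PEC K} {R : Fin K → ℝ} (hR : Achievable W R)
    (π : Equiv.Perm (Fin K)) {j : Fin K} (hj : W.pUnion (firstReceivers π j) = 0) :
    R (π j) = 0 := by
  refine le_antisymm (not_lt.1 fun hpos => ?_) (hR.1 _)
  -- At error probability `1/2` at most two symbols get through, so `n * R (π j) < 3`.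
  obtain ⟨n₀, hn₀⟩ := exists_nat_gt (3 / R (π j))
  obtain ⟨n, hn, F, _, _, C, hC⟩ := hR.2 (1 / 2) (by norm_num) n₀
  have h := C.message_le_one_of_pUnion_eq_zero W π (fun k => (hC k).le) hj
  have hfl := Nat.lt_floor_add_one ((n : ℝ) * R (π j))
  have hn' : (n₀ : ℝ) ≤ n := by exact_mod_cast hn
  have := (div_lt_iff₀ hpos).1 (hn₀.trans_le hn')
  linarith

lemma Achievable.sum_div_le_one {W : PEC K} {R : Fin K → ℝ} (hR : Achievable W R)
    (π : Equiv.Perm (Fin K)) : ∑ j, R (π j) / W.pUnion (firstReceivers π j) ≤ 1 := by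
  set A := ∑ j, R (π j) / W.pUnion (firstReceivers π j) with hA
  set B := ∑ j, 1 / W.pUnion (firstReceivers π j) with hB
  have hB0 : 0 ≤ B := Finset.sum_nonneg fun j _ => div_nonneg zero_le_one (W.pUnion_nonneg _)
  have hbound : ∀ ε : ℝ, 0 < ε → ε < 1 → (1 - ε) * A ≤ 1 + ε := by
    intro ε hε hε1
    -- The floor and Fano's inequality cost at most two symbols per session, which is at most
    -- `n * ε` after weighting once `n` exceeds `2 * B / ε`.
    obtain ⟨n₀, hn₀⟩ := exists_nat_gt (2 * B / ε)
    obtain ⟨n, hn, F, _, _, C, hC⟩ := hR.2 ε hε n₀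
    have hn' : (n₀ : ℝ) ≤ n := by exact_mod_cast hn
    have hlt := hn₀.trans_le hn'
    have hnpos : (0 : ℝ) < n := lt_of_le_of_lt (by positivity) hlt
    rw [div_lt_iff₀ hε] at hlt
    have hle : (1 - ε) * n * A - 2 * B ≤ n := by
      refine le_trans ?_ (C.sum_message_div_le W π fun k => (hC k).le)
      rw [hA, hB, Finset.mul_sum, Finset.mul_sum, ← Finset.sum_sub_distrib]
      refine Finset.sum_le_sum fun j _ => ?_
      have : (1 - ε) * n * (R (π j) / W.pUnion (firstReceivers π j)) -
          2 * (1 / W.pUnion (firstReceivers π j)) =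
          ((1 - ε) * (n * R (π j)) - 2) / W.pUnion (firstReceivers π j) := by ring
      rw [this]
      refine div_le_div_of_nonneg_right ?_ (W.pUnion_nonneg _)
      have hfl := Nat.lt_floor_add_one ((n : ℝ) * R (π j))
      nlinarith [mul_le_mul_of_nonneg_left hfl.le (sub_nonneg.2 hε1.le)]
    refine le_of_mul_le_mul_left ?_ hnpos
    linarith
  by_contra! h
  have := hbound ((A - 1) / (2 * (A + 1))) (div_pos (by linarith) (by linarith))
    ((div_lt_one (by linarith)).2 (by linarith))
  have hx : (A - 1) / (2 * (A + 1)) * (2 * (A + 1)) = A - 1 :=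
    div_mul_cancel₀ _ (by linarith)
  linarith

end

end BroadcastErasure

theorem proposition1 {K : ℕ} (W : BroadcastErasure.PEC K) (R : Fin K → ℝ)
    (hR : BroadcastErasure.Achievable W R) (π : Equiv.Perm (Fin K)) :
    (∀ j : Fin K, W.pUnion (BroadcastErasure.firstReceivers π j) = 0 → R (π j) = 0) ∧
      ∑ j : Fin K, R (π j) / W.pUnion (BroadcastErasure.firstReceivers π j) ≤ 1 :=
  ⟨fun _ hj => hR.eq_zero_of_pUnion_eq_zero π hj, hR.sum_div_le_one π⟩
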